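/- Let $M$ be a smooth finite-dimensional Riemannian manifold without boundary, let $f\colon M\to M$ be a $C^{1+\varepsilon}$ map for some $0<\varepsilon\le 1$ (that is, $f$ is $C^1$ and its derivative is locally $\varepsilon$-Hölder in charts), and let $\Lambda\subset M$ be a compact locally maximal $f$-invariant set, i.e. $f(\Lambda)\subset\Lambda$ and $\Lambda=\bigcap_{n\in\mathbb Z}f^n(U)$ for some open $U\supset\Lambda$, where $f^{n}(U)$ for $n<0$ denotes the preimage of $U$ under $f^{|n|}$. Notation. For $x\in\Lambda$ let $\lambda_1(x)=\min_{0\ne v\in T_xM}\limsup_{n\to\infty}\frac1n\log\|df^n(x)v\|$ be the smallest Lyapunov exponent at $x$ (with $\log 0=-\infty$). Let $\mathcal M$ be the set of $f$-invariant Borel probability measures on $\Lambda$; for $\mu\in\mathcal M$ put $\lambda_1(\mu)=\int\lambda_1\,d\mu$, and let $h_\mu(f)$ be its (Kolmogorov–Sinai) entropy. For $\psi\in C(\Lambda,\mathbb R)$ put $S_n\psi=\sum_{k=0}^{n-1}\psi\circ f^k$, and let $P_{\rm top}(\psi)$ be the topological pressure of $\psi$ with respect to $f|_\Lambda$. The generalized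 entropy of $\nu\in\mathcal M$ is $$\widehat h_\nu(f)=-\sup_{\psi\in C(\Lambda,\mathbb R)}\Big(\int_\Lambda\psi\,d\nu-P_{\rm top}(\psi)\Big).$$ For $n,\ell\ge1$ and $\alpha>0$ let ${\rm EFix}(f^n,\alpha,\ell)$ be the set of $x\in\Lambda$ with $f^n(x)=x$, $\lambda_1(x)>0$ and $$\min_{\|v\|=1}\|df^k(f^i(x))v\|\ \ge\ \frac1\ell e^{k\alpha}\qquad\text{for all integers }k\ge0\text{ and }0\le i\le n-1.$$ **Theorem.** Let $\mu\in\mathcal M$ be ergodic with $\lambda_1(\mu)>0$ and $h_\mu(f)>0$, and let $\varphi\in C(\Lambda,\mathbb R)$. Then for all $\alpha>0$ and $\delta>0$ the limit as $\ell\to\infty$ below exists in $[-\infty,\infty]$ and $$\lim_{\ell\to\infty}\limsup_{n\to\infty}\frac1n\log{\rm card}\Big\{x\in{\rm EFix}(f^n,\alpha,\ell)\colon\Big|\frac1nS_n\varphi(x)-\int_\Lambda\varphi\,d\mu\Big|\ge\delta\Big\}\ \le\ \sup\Big\{\widehat h_\nu(f)\colon\nu\in\mathcal M,\ \Big|\int_\Lambda\varphi\,d\nu-\int_\Lambda\varphi\,d\mu\Big|\ge\delta\Big\},$$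 with the conventions $\log 0=-\infty$ and $\sup\emptyset=-\infty$. -/

import Mathlib

open Set Filter Topology MeasureTheory Bundle
open scoped Manifold ContDiff ENNReal NNReal

noncomputable section

namespace LargeDev

/-! ### Topological pressure and entropies of a continuous self-map of a compact space -/

/-- `F` is `(n, ε)`-separated: two distinct points of `F` satisfy `d_n(x, y) > ε`, where
`d_n(x, y) = max_{0 ≤ k < n} d(T^k x, T^k y)`. -/
def IsDynSeparated {X : Type*} [PseudoEMetricSpace X] (T : X → X) (n : ℕ) (ε : ℝ≥0∞)
    (F : Finset X) : Prop :=
  ∀ x ∈ F, ∀ y ∈ F, x ≠ y → ∃ k < n, ε < edist (T^[k] x) (T^[k] y)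

/-- The largest value of `∑_{x ∈ F} exp (S_n ψ (x))` over all `(n, ε)`-separated sets `F`. -/
def sepSum {X : Type*} [PseudoEMetricSpace X] (T : X → X) (ψ : X → ℝ) (n : ℕ) (ε : ℝ≥0∞) :
    ℝ≥0∞ :=
  ⨆ (F : Finset X) (_ : IsDynSeparated T n ε F),
    ∑ x ∈ F, ENNReal.ofReal (Real.exp (birkhoffSum T ψ n x))

/-- The topological pressure `lim_{ε → 0} limsup_n (1/n) log (sup_F ∑_{x ∈ F} exp (S_n ψ (x)))`.
The inner quantity increases as `ε` decreases, so that the limit is the supremum over `ε > 0`. -/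
def topPressure {X : Type*} [PseudoEMetricSpace X] (T : X → X) (ψ : X → ℝ) : EReal :=
  ⨆ (ε : ℝ≥0∞) (_ : 0 < ε),
    limsup (fun n : ℕ => ENNReal.log (sepSum T ψ n ε) / (n : EReal)) atTop

/-- The set of `T`-invariant Borel probability measures. -/
def invariantMeasures {X : Type*} [MeasurableSpace X] (T : X → X) : Set (Measure X) :=
  {ν | IsProbabilityMeasure ν ∧ MeasurePreserving T ν ν}

/-- The generalized entropy `- sup_ψ (∫ ψ dν - P_top(ψ))`, over continuous `ψ : X → ℝ`. -/
def genEntropy {X : Type*} [PseudoEMetricSpace X] [MeasurableSpace X] (T : X → X)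
    (ν : Measure X) : EReal :=
  - ⨆ ψ : C(X, ℝ), (((∫ x, ψ x ∂ν : ℝ) : EReal) - topPressure T ψ)

/-- The Shannon entropy of the join `ξ ∨ T⁻¹ξ ∨ ⋯ ∨ T^{-(n-1)}ξ` of the finite partition
of `X` into the fibres of `ξ`. -/
def joinEntropy {X : Type*} [MeasurableSpace X] (T : X → X) (μ : Measure X) {k : ℕ}
    (ξ : X → Fin k) (n : ℕ) : ℝ :=
  ∑ a : Fin n → Fin k, Real.negMulLog (μ.real {x | ∀ j : Fin n, ξ (T^[j] x) = a j})

/-- The Kolmogorov–Sinai entropy: the supremum over all finite measurable partitions `ξ` of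
`lim_n (1/n) H(ξ ∨ ⋯ ∨ T^{-(n-1)}ξ)`. -/
def ksEntropy {X : Type*} [MeasurableSpace X] (T : X → X) (μ : Measure X) : EReal :=
  ⨆ (k : ℕ) (ξ : X → Fin k) (_ : Measurable ξ),
    limsup (fun n : ℕ => ((joinEntropy T μ ξ n / n : ℝ) : EReal)) atTop

/-- The integral of an extended real function, as the difference of the integrals of its
positive and negative parts. -/
def erealIntegral {X : Type*} [MeasurableSpace X] (g : X → EReal) (μ : Measure X) : EReal :=
  ((∫⁻ x, (g x).toENNReal ∂μ : ℝ≥0∞) : EReal) - ((∫⁻ x, (-g x).toENNReal ∂μ : ℝ≥0∞) : EReal)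

/-- The minimum norm `min {‖A v‖ : ‖v‖ = 1}` of a linear map, equal to `‖A⁻¹‖⁻¹` if `A` is
invertible and to `0` if `A` has a nontrivial kernel. -/
def minNorm {V W : Type*} [Norm V] [Norm W] (A : V → W) : ℝ :=
  ⨅ v : {v : V // ‖v‖ = 1}, ‖A v.1‖

/-- `Λ = ⋂_{n ∈ ℤ} f^n(U)` for an open neighbourhood `U` of `Λ`, where `f^{-n}(U)` denotes the
preimage of `U` under `f^n`. -/
def IsLocallyMaximal {M : Type*} [TopologicalSpace M] (f : M → M) (Λ : Set M) : Prop :=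
  ∃ U : Set M, IsOpen U ∧ Λ ⊆ U ∧ Λ = ⋂ n : ℕ, ((f^[n] '' U) ∩ (f^[n] ⁻¹' U))

section Manifold

variable {d : ℕ} {M : Type*} [EMetricSpace M] [ChartedSpace (EuclideanSpace ℝ (Fin d)) M]

/-- `f` is of class `C^{1+ε}`: it is `C^1`, and in charts its derivative is locally Hölder
continuous with exponent `ε`. -/
def IsC1Holder (d : ℕ) {M : Type*} [EMetricSpace M] [ChartedSpace (EuclideanSpace ℝ (Fin d)) M]
    (ε : ℝ≥0) (f : M → M) : Prop :=
  ContMDiff (𝓡 d) (𝓡 d) 1 f ∧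
    ∀ x : M, ∃ s ∈ 𝓝 (extChartAt (𝓡 d) x x), ∃ C : ℝ≥0,
      HolderOnWith C ε (fderiv ℝ (writtenInExtChartAt (𝓡 d) (𝓡 d) x f)) s

variable [RiemannianBundle (fun x : M => TangentSpace (𝓡 d) x)]

/-- The Lyapunov exponent `limsup_n (1/n) log ‖df^n(x) v‖` of the tangent vector `v` at `x`,
with `log 0 = -∞`. -/
def lyapunov (f : M → M) (x : M) (v : TangentSpace (𝓡 d) x) : EReal :=
  limsup (fun n : ℕ =>
    ENNReal.log (ENNReal.ofReal ‖mfderiv (𝓡 d) (𝓡 d) (f^[n]) x v‖) / (n : EReal)) atTop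

/-- The smallest Lyapunov exponent `λ₁(x)` at `x`. -/
def lyapunovMin (d : ℕ) {M : Type*} [EMetricSpace M]
    [ChartedSpace (EuclideanSpace ℝ (Fin d)) M]
    [RiemannianBundle (fun x : M => TangentSpace (𝓡 d) x)] (f : M → M) (x : M) : EReal :=
  ⨅ (v : TangentSpace (𝓡 d) x) (_ : v ≠ 0), lyapunov f x v

/-- The smallest Lyapunov exponent `λ₁(μ) = ∫ λ₁(x) dμ(x)` of a measure on `Λ`. -/
def lyapunovMinMeasure (d : ℕ) {M : Type*} [EMetricSpace M]
    [ChartedSpace (EuclideanSpace ℝ (Fin d)) M]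
    [RiemannianBundle (fun x : M => TangentSpace (𝓡 d) x)] [MeasurableSpace M]
    (f : M → M) {Λ : Set M} (μ : Measure Λ) : EReal :=
  erealIntegral (fun x : Λ => lyapunovMin d f (x : M)) μ

/-- `EFix(f^n, α, ℓ)`: the fixed points `x ∈ Λ` of `f^n` which are expanding (`λ₁(x) > 0`) and
satisfy `‖(df^k(f^i(x)))⁻¹‖⁻¹ ≥ (1/ℓ) e^{kα}` for all `k` and all `0 ≤ i ≤ n - 1`. -/
def EFix (d : ℕ) {M : Type*} [EMetricSpace M] [ChartedSpace (EuclideanSpace ℝ (Fin d)) M]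
    [RiemannianBundle (fun x : M => TangentSpace (𝓡 d) x)]
    (f : M → M) (Λ : Set M) (n : ℕ) (α : ℝ) (ℓ : ℕ) : Set Λ :=
  {x | f^[n] (x : M) = x ∧ 0 < lyapunovMin d f (x : M) ∧
    ∀ k : ℕ, ∀ i < n, (1 / (ℓ : ℝ)) * Real.exp (k * α) ≤
      minNorm (mfderiv (𝓡 d) (𝓡 d) (f^[k]) (f^[i] (x : M)))}

end Manifold

end LargeDev

end

namespace LargeDev

/-! For fixed `ℓ ≥ 1`, two distinct points of `EFix` with the same period `n` are `(n, ε)`-separated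
for some `ε` independent of `n` (`exists_isDynSeparated_EFix`). Otherwise their orbits, being
periodic, would stay close forever, while a fixed iterate `f^[N]` doubles their distance in charts
along the orbit of the first point.

Separation lets pressure count periodic points (`limsup_log_encard_periodic_le`). The empirical
measure of a periodic point in the deviation set lies in a weak-* compact set `K` of invariant
measures. If `a` exceeds the generalized entropy on `K`, each `ν ∈ K` has a potential `ψ` with `∫ ψ
dν > P(ψ) - a`. This condition is open in `ν`, so finitely many potentials serve all of `K`, and an
exponential Chebyshev inequality for each yields growth rate at most `a`.

The bound is uniform in `ℓ`, and the sets increase with `ℓ ≥ 1`, so the limit exists. -/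

/-! ### Empirical measures of periodic orbits -/

/-- The empirical measure `(1/n) ∑_{k < n} δ_{T^k x}`. -/
noncomputable def empiricalMeasure {X : Type*} [MeasurableSpace X] (T : X → X) (n : ℕ) (x : X) :
    Measure X :=
  (n : ℝ≥0∞)⁻¹ • ∑ k ∈ Finset.range n, Measure.dirac (T^[k] x)

theorem isProbabilityMeasure_empiricalMeasure {X : Type*} [MeasurableSpace X] (T : X → X) {n : ℕ}
    (hn : n ≠ 0) (x : X) : IsProbabilityMeasure (empiricalMeasure T n x) := by
  constructor
  simp only [empiricalMeasure, Measure.smul_apply, Measure.finsetSum_apply, measure_univ,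
    Finset.sum_const, Finset.card_range, smul_eq_mul, nsmul_eq_mul, mul_one]
  exact ENNReal.inv_mul_cancel (by exact_mod_cast hn) (ENNReal.natCast_ne_top n)

/-- Pushing forward shifts the sum of Dirac masses by one. The two ways of splitting the sum over `k
≤ n` differ only in the end terms, which agree by periodicity and cancel because a Dirac mass is
finite. -/
theorem measurePreserving_empiricalMeasure {X : Type*} [MeasurableSpace X] {T : X → X}
    (hT : Measurable T) {n : ℕ} {x : X} (hx : T^[n] x = x) :
    MeasurePreserving T (empiricalMeasure T n x) (empiricalMeasure T n x) := by
  refine ⟨hT, ?_⟩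
  rw [empiricalMeasure, Measure.map_smul, Measure.map_finset_sum hT.aemeasurable]
  congr 1
  simp_rw [Measure.map_dirac' hT, ← Function.iterate_succ_apply' T]
  have h := (Finset.sum_range_succ (fun k => Measure.dirac (T^[k] x)) n).symm.trans
    (Finset.sum_range_succ' (fun k => Measure.dirac (T^[k] x)) n)
  ext s hs
  have h' := congrArg (fun m : Measure X => m s) h
  simp only [Measure.coe_add, Pi.add_apply, hx, Function.iterate_zero, id] at h'
  have hfin : Measure.dirac x s ≠ ⊤ := measure_ne_top _ _
  exact ((ENNReal.add_left_inj hfin).1 h').symm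

theorem integral_empiricalMeasure {X : Type*} [TopologicalSpace X] [CompactSpace X]
    [MeasurableSpace X] [OpensMeasurableSpace X] (T : X → X) (n : ℕ) (x : X) (ψ : C(X, ℝ)) :
    ∫ y, ψ y ∂(empiricalMeasure T n x) = (1 / (n : ℝ)) * birkhoffSum T ψ n x := by
  have hm : StronglyMeasurable (fun y => ψ y) := ψ.continuous.measurable.stronglyMeasurable
  rw [empiricalMeasure, integral_smul_measure, integral_finsetSum_measure]
  · simp only [integral_dirac' _ _ hm, birkhoffSum]
    simp
  · intro k _
    exact (BoundedContinuousFunction.mkOfCompact ψ).integrable _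

/-- Invariant measures form a closed set of probability measures. -/
theorem isClosed_invariant {X : Type*} [EMetricSpace X] [MeasurableSpace X] [BorelSpace X]
    {T : X → X} (hT : Continuous T) :
    IsClosed {ν : ProbabilityMeasure X | MeasurePreserving T (ν : Measure X) ν} := by
  have : {ν : ProbabilityMeasure X | MeasurePreserving T (ν : Measure X) ν} =
      {ν | ν.map hT.measurable.aemeasurable = ν} := by
    ext ν
    simp only [mem_ofPred_eq]
    rw [← ProbabilityMeasure.toMeasure_injective.eq_iff, ProbabilityMeasure.toMeasure_map]
    exact ⟨fun h => h.map_eq, fun h => ⟨hT.measurable, h⟩⟩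
  rw [this]
  exact isClosed_eq (ProbabilityMeasure.continuous_map hT) continuous_id

/-! ### Pressure and the counting of separated periodic points -/

/-- A value above the generalized entropy is witnessed by a continuous potential. -/
theorem exists_potential_of_genEntropy_lt {X : Type*} [PseudoEMetricSpace X] [MeasurableSpace X]
    {T : X → X} {ν : Measure X} {a : ℝ} (h : genEntropy T ν < a) :
    ∃ (ψ : C(X, ℝ)) (p : ℝ), topPressure T ψ < p ∧ p - a < ∫ x, ψ x ∂ν := by
  rw [genEntropy, EReal.neg_lt_comm] at h
  obtain ⟨ψ, hψ⟩ := lt_iSup_iff.1 h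
  -- The pressure may be infinite: `⊥` makes the claim trivial, and `⊤` would turn the difference in
  -- `hψ` into `⊥`.
  have h2 : topPressure T ψ < ((∫ x, ψ x ∂ν + a : ℝ) : EReal) := by
    generalize topPressure T ψ = P at hψ
    induction P with
    | bot => exact EReal.bot_lt_coe _
    | top => simp at hψ
    | coe P =>
      norm_cast at hψ ⊢
      linarith
  obtain ⟨p, hp1, hp2⟩ := EReal.lt_iff_exists_real_btwn.1 h2
  refine ⟨ψ, p, hp1, ?_⟩
  norm_cast at hp2
  linarith

theorem log_div_le_iff {n : ℕ} (hn : n ≠ 0) (c : ℝ≥0∞) (p : ℝ) :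
    ENNReal.log c / (n : EReal) ≤ p ↔ c ≤ ENNReal.ofReal (Real.exp (n * p)) := by
  have h1 : (0 : EReal) < (n : EReal) := by exact_mod_cast Nat.pos_of_ne_zero hn
  rw [EReal.div_le_iff_le_mul h1 (EReal.natCast_ne_top n), ← ENNReal.log_le_log_iff,
    ENNReal.log_ofReal_of_pos (Real.exp_pos _), Real.log_exp]
  norm_cast

theorem eventually_sepSum_le {X : Type*} [PseudoEMetricSpace X] {T : X → X} {ψ : X → ℝ} {p : ℝ}
    (h : topPressure T ψ < p) {ε : ℝ≥0∞} (hε : 0 < ε) :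
    ∀ᶠ n : ℕ in atTop, sepSum T ψ n ε ≤ ENNReal.ofReal (Real.exp (n * p)) := by
  have h1 : limsup (fun n : ℕ => ENNReal.log (sepSum T ψ n ε) / (n : EReal)) atTop < p :=
    lt_of_le_of_lt (le_iSup₂ (f := fun (ε : ℝ≥0∞) (_ : 0 < ε) =>
      limsup (fun n : ℕ => ENNReal.log (sepSum T ψ n ε) / (n : EReal)) atTop) ε hε) h
  filter_upwards [eventually_lt_of_limsup_lt h1, eventually_ne_atTop 0] with n hn hn0
  exact (log_div_le_iff hn0 _ _).1 hn.le

/-- `sepSum` sees only finite sets, and finiteness of the set of periodic points is not known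
beforehand; an infinite set forces `b = ⊤`. -/
theorem encard_le_of_forall_finset {X : Type*} {s : Set X} {b : ℝ≥0∞}
    (h : ∀ F : Finset X, (F : Set X) ⊆ s → (F.card : ℝ≥0∞) ≤ b) :
    ((s.encard : ℕ∞) : ℝ≥0∞) ≤ b := by
  rcases s.finite_or_infinite with hs | hs
  · have := h hs.toFinset (by simp)
    rw [hs.encard_eq_coe_toFinset_card]
    exact_mod_cast this
  · have : b = ⊤ := by
      refine ENNReal.eq_top_of_forall_nnreal_le fun r => ?_
      obtain ⟨m, hm⟩ := exists_nat_ge r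
      obtain ⟨F, hF, hFm⟩ := hs.exists_subset_card_eq m
      refine le_trans ?_ (h F hF)
      rw [hFm]
      exact_mod_cast hm
    rw [this]
    exact le_top

/-- The upper large deviation bound for separated sets of periodic points. -/
theorem limsup_log_encard_periodic_le {X : Type*} [EMetricSpace X] [CompactSpace X]
    [MeasurableSpace X] [BorelSpace X] {T : X → X} (hT : Continuous T) (φ : C(X, ℝ)) {A : Set ℝ}
    (hA : IsClosed A) (S : ℕ → Set X) {ε : ℝ≥0∞} (hε : 0 < ε)
    (hsep : ∀ n ≠ 0, ∀ F : Finset X, (F : Set X) ⊆ S n → IsDynSeparated T n ε F)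
    (hper : ∀ n, ∀ x ∈ S n, T^[n] x = x)
    (hSA : ∀ n, ∀ x ∈ S n, (1 / (n : ℝ)) * birkhoffSum T φ n x ∈ A) :
    limsup (fun n : ℕ => ENNReal.log (((S n).encard : ℕ∞) : ℝ≥0∞) / (n : EReal)) atTop ≤
      ⨆ ν ∈ {ν : Measure X | ν ∈ invariantMeasures T ∧ ∫ y, φ y ∂ν ∈ A}, genEntropy T ν := by
  set L := ⨆ ν ∈ {ν : Measure X | ν ∈ invariantMeasures T ∧ ∫ y, φ y ∂ν ∈ A}, genEntropy T ν
    with hL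
  refine EReal.le_of_forall_lt_iff_le.1 fun b hb => ?_
  -- The gap between `a` and `b` will absorb the number of potentials in the finite cover.
  obtain ⟨a, hLa, hab⟩ := EReal.lt_iff_exists_real_btwn.1 hb
  replace hab : a < b := by exact_mod_cast hab
  set K : Set (ProbabilityMeasure X) :=
    {ν | MeasurePreserving T (ν : Measure X) ν} ∩ {ν | ∫ y, φ y ∂(ν : Measure X) ∈ A} with hK
  have hKc : IsCompact K := by
    refine IsClosed.isCompact (IsClosed.inter (isClosed_invariant hT) ?_)
    exact hA.preimage (ProbabilityMeasure.continuous_integral_continuousMap φ)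
  have hw : ∀ ν : K, ∃ (ψ : C(X, ℝ)) (p : ℝ), topPressure T ψ < p ∧
      p - a < ∫ x, ψ x ∂(ν.1 : Measure X) := fun ν => by
    refine exists_potential_of_genEntropy_lt (lt_of_le_of_lt ?_ hLa)
    exact le_iSup₂ (f := fun (ν : Measure X) (_ : ν ∈ {ν : Measure X | ν ∈ invariantMeasures T ∧
      ∫ y, φ y ∂ν ∈ A}) => genEntropy T ν) (ν.1 : Measure X) ⟨⟨inferInstance, ν.2.1⟩, ν.2.2⟩
  choose ψ p hp hψ using hw
  obtain ⟨t, ht⟩ := hKc.elim_finite_subcover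
    (fun ν : K => {m : ProbabilityMeasure X | p ν - a < ∫ x, ψ ν x ∂(m : Measure X)})
    (fun ν => isOpen_lt continuous_const
      (ProbabilityMeasure.continuous_integral_continuousMap (ψ ν)))
    (fun ν hν => mem_iUnion.2 ⟨⟨ν, hν⟩, hψ ⟨ν, hν⟩⟩)
  have hev : ∀ᶠ n : ℕ in atTop, ∀ ν ∈ t,
      sepSum T (ψ ν) n ε ≤ ENNReal.ofReal (Real.exp (n * p ν)) :=
    (Filter.eventually_all_finset t).2 fun ν _ => eventually_sepSum_le (hp ν) hε
  have hcard : ∀ᶠ n : ℕ in atTop, (t.card : ℝ) ≤ Real.exp (n * (b - a)) := by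
    have : Tendsto (fun n : ℕ => Real.exp (n * (b - a))) atTop atTop :=
      Real.tendsto_exp_atTop.comp
        (tendsto_natCast_atTop_atTop.atTop_mul_const (sub_pos.2 hab))
    exact this.eventually_ge_atTop _
  refine limsup_le_of_le (by isBoundedDefault) ?_
  filter_upwards [hev, hcard, eventually_ne_atTop 0] with n hn hcn hn0
  rw [log_div_le_iff hn0]
  refine encard_le_of_forall_finset fun F hF => ?_
  -- Chebyshev weights: the empirical measure of `x` lies in `K`, hence in one set of the cover,
  -- where `S_n ψ(x) > n (p - a)`; that single term is already at least `1`.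
  have hone : ∀ x ∈ F, (1 : ℝ≥0∞) ≤ ∑ ν ∈ t, ENNReal.ofReal (Real.exp (n * (a - p ν))) *
      ENNReal.ofReal (Real.exp (birkhoffSum T (ψ ν) n x)) := fun x hx => by
    have := isProbabilityMeasure_empiricalMeasure T hn0 x
    have hmem : (⟨empiricalMeasure T n x, this⟩ : ProbabilityMeasure X) ∈ K := by
      refine ⟨measurePreserving_empiricalMeasure hT.measurable (hper n x (hF hx)), ?_⟩
      change ∫ y, φ y ∂(empiricalMeasure T n x) ∈ A
      rw [integral_empiricalMeasure]
      exact hSA n x (hF hx)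
    obtain ⟨ν, hν, hlt⟩ := mem_iUnion₂.1 (ht hmem)
    change p ν - a < ∫ y, ψ ν y ∂(empiricalMeasure T n x) at hlt
    rw [integral_empiricalMeasure] at hlt
    refine le_trans ?_ (Finset.single_le_sum (fun _ _ => zero_le) hν)
    rw [← ENNReal.ofReal_mul (Real.exp_pos _).le, ← Real.exp_add, ENNReal.one_le_ofReal]
    refine Real.one_le_exp ?_
    have hnpos : (0 : ℝ) < n := by exact_mod_cast Nat.pos_of_ne_zero hn0
    have := mul_lt_mul_of_pos_left hlt hnpos
    rw [← mul_assoc, mul_one_div_cancel hnpos.ne', one_mul] at this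
    linarith
  calc (F.card : ℝ≥0∞) = ∑ x ∈ F, 1 := by simp
    _ ≤ ∑ x ∈ F, ∑ ν ∈ t, ENNReal.ofReal (Real.exp (n * (a - p ν))) *
      ENNReal.ofReal (Real.exp (birkhoffSum T (ψ ν) n x)) := Finset.sum_le_sum hone
    _ = ∑ ν ∈ t, ENNReal.ofReal (Real.exp (n * (a - p ν))) *
      ∑ x ∈ F, ENNReal.ofReal (Real.exp (birkhoffSum T (ψ ν) n x)) := by
        rw [Finset.sum_comm]
        simp_rw [Finset.mul_sum]
    _ ≤ ∑ ν ∈ t, ENNReal.ofReal (Real.exp (n * a)) := by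
        refine Finset.sum_le_sum fun ν hν => ?_
        have h1 : ∑ x ∈ F, ENNReal.ofReal (Real.exp (birkhoffSum T (ψ ν) n x)) ≤
            sepSum T (ψ ν) n ε :=
          le_iSup₂ (f := fun (F : Finset X) (_ : IsDynSeparated T n ε F) =>
            ∑ x ∈ F, ENNReal.ofReal (Real.exp (birkhoffSum T (ψ ν) n x))) F (hsep n hn0 F hF)
        refine (mul_le_mul_right (h1.trans (hn ν hν)) _).trans ?_
        rw [← ENNReal.ofReal_mul (Real.exp_pos _).le, ← Real.exp_add]
        refine le_of_eq ?_
        congr 2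
        ring
    _ = ENNReal.ofReal (t.card * Real.exp (n * a)) := by
        rw [Finset.sum_const, nsmul_eq_mul, ENNReal.ofReal_mul (Nat.cast_nonneg _),
          ENNReal.ofReal_natCast]
    _ ≤ ENNReal.ofReal (Real.exp (n * b)) := by
        refine ENNReal.ofReal_le_ofReal ?_
        calc (t.card : ℝ) * Real.exp (n * a) ≤ Real.exp (n * (b - a)) * Real.exp (n * a) :=
              mul_le_mul_of_nonneg_right hcn (Real.exp_pos _).le
          _ = Real.exp (n * b) := by rw [← Real.exp_add]; congr 1; ring

theorem minNorm_mul_norm_le {V W : Type*} [NormedAddCommGroup V] [NormedSpace ℝ V]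
    [NormedAddCommGroup W] [NormedSpace ℝ W] (A : V →L[ℝ] W) (v : V) :
    minNorm A * ‖v‖ ≤ ‖A v‖ := by
  rcases eq_or_ne v 0 with rfl | hv
  · simp
  have hv' : 0 < ‖v‖ := norm_pos_iff.2 hv
  have h : minNorm A ≤ ‖A (‖v‖⁻¹ • v)‖ :=
    ciInf_le (f := fun v : {v : V // ‖v‖ = 1} => ‖A v.1‖) ⟨0, by rintro _ ⟨u, rfl⟩; positivity⟩
      ⟨‖v‖⁻¹ • v, by rw [norm_smul, norm_inv, norm_norm, inv_mul_cancel₀ hv'.ne']⟩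
  rw [map_smul, norm_smul, norm_inv, norm_norm] at h
  calc minNorm A * ‖v‖ ≤ (‖v‖⁻¹ * ‖A v‖) * ‖v‖ := mul_le_mul_of_nonneg_right h hv'.le
    _ = ‖A v‖ := by field_simp

/-! ### Expansion measured in charts -/

section Manifold

variable {d : ℕ} {M : Type*} [EMetricSpace M] [ChartedSpace (EuclideanSpace ℝ (Fin d)) M]
  [IsManifold (𝓡 d) ∞ M]

/-- The map `F` read in the charts centred at `p` and `q`. -/
noncomputable def inCharts (d : ℕ) {M : Type*} [EMetricSpace M]
    [ChartedSpace (EuclideanSpace ℝ (Fin d)) M] (F : M → M) (p q : M) :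
    EuclideanSpace ℝ (Fin d) → EuclideanSpace ℝ (Fin d) :=
  fun u => extChartAt (𝓡 d) q (F ((extChartAt (𝓡 d) p).symm u))

/-- The derivative at `x` of the chart centred at `p`. -/
noncomputable def chartDeriv (d : ℕ) {M : Type*} [EMetricSpace M]
    [ChartedSpace (EuclideanSpace ℝ (Fin d)) M] [IsManifold (𝓡 d) ∞ M] (p x : M) :
    TangentSpace (𝓡 d) x →L[ℝ] EuclideanSpace ℝ (Fin d) :=
  (trivializationAt (EuclideanSpace ℝ (Fin d)) (TangentSpace (𝓡 d)) p).continuousLinearMapAt ℝ x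

theorem chartDeriv_surjective {p x : M} (hx : x ∈ (extChartAt (𝓡 d) p).source) :
    Function.Surjective (chartDeriv d p x) := fun v =>
  ⟨(trivializationAt (EuclideanSpace ℝ (Fin d)) (TangentSpace (𝓡 d)) p).symmL ℝ x v,
    Trivialization.continuousLinearMapAt_symmL _ (by simpa using hx) v⟩

theorem contDiffAt_inCharts {F : M → M} (hF : ContMDiff (𝓡 d) (𝓡 d) 1 F) {p q z : M}
    (hz : z ∈ (extChartAt (𝓡 d) p).source) (hFz : F z ∈ (extChartAt (𝓡 d) q).source) :
    ContDiffAt ℝ 1 (inCharts d F p q) (extChartAt (𝓡 d) p z) := by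
  rw [← contMDiffAt_iff_contDiffAt]
  have h1 : ContMDiffAt 𝓘(ℝ, EuclideanSpace ℝ (Fin d)) (𝓡 d) 1 (extChartAt (𝓡 d) p).symm
      (extChartAt (𝓡 d) p z) :=
    (contMDiffOn_extChartAt_symm p).contMDiffAt
      ((isOpen_extChartAt_target p).mem_nhds ((extChartAt (𝓡 d) p).map_source hz))
  have h2 : ContMDiffAt (𝓡 d) 𝓘(ℝ, EuclideanSpace ℝ (Fin d)) 1 (extChartAt (𝓡 d) q) (F z) :=
    contMDiffAt_extChartAt' (by simpa using hFz)
  have hs : (extChartAt (𝓡 d) p).symm (extChartAt (𝓡 d) p z) = z :=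
    (extChartAt (𝓡 d) p).left_inv hz
  have h3 := (hF z).comp_of_eq h1 hs
  exact h2.comp_of_eq h3 (by simp [hs, -extChartAt])

/-- The chain rule on both sides of `g ∘ φ_p = φ_q ∘ F` near `x`, where `g` is `inCharts d F p q`;
the tangent bundle trivialization is the derivative of the chart. -/
theorem fderiv_inCharts_chartDeriv {F : M → M} (hF : ContMDiff (𝓡 d) (𝓡 d) 1 F) {p q x : M}
    (hx : x ∈ (extChartAt (𝓡 d) p).source) (hFx : F x ∈ (extChartAt (𝓡 d) q).source)
    (w : TangentSpace (𝓡 d) x) :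
    fderiv ℝ (inCharts d F p q) (extChartAt (𝓡 d) p x) (chartDeriv d p x w) =
      chartDeriv d q (F x) (mfderiv (𝓡 d) (𝓡 d) F x w) := by
  have hx' : x ∈ (chartAt (EuclideanSpace ℝ (Fin d)) p).source := by simpa using hx
  have hFx' : F x ∈ (chartAt (EuclideanSpace ℝ (Fin d)) q).source := by simpa using hFx
  have hF' : MDifferentiableAt (𝓡 d) (𝓡 d) F x := (hF x).mdifferentiableAt one_ne_zero
  have hp : MDifferentiableAt (𝓡 d) 𝓘(ℝ, EuclideanSpace ℝ (Fin d)) (extChartAt (𝓡 d) p) x :=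
    mdifferentiableAt_extChartAt hx'
  have hq : MDifferentiableAt (𝓡 d) 𝓘(ℝ, EuclideanSpace ℝ (Fin d)) (extChartAt (𝓡 d) q) (F x) :=
    mdifferentiableAt_extChartAt hFx'
  have hg : MDifferentiableAt 𝓘(ℝ, EuclideanSpace ℝ (Fin d)) 𝓘(ℝ, EuclideanSpace ℝ (Fin d))
      (inCharts d F p q) (extChartAt (𝓡 d) p x) :=
    ((contDiffAt_inCharts hF hx hFx).differentiableAt one_ne_zero).mdifferentiableAt
  have heq : inCharts d F p q ∘ extChartAt (𝓡 d) p =ᶠ[𝓝 x] extChartAt (𝓡 d) q ∘ F := by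
    filter_upwards [extChartAt_source_mem_nhds' hx] with y hy
    simp only [inCharts, Function.comp_apply, (extChartAt (𝓡 d) p).left_inv hy]
  have h := heq.mfderiv_eq (I := 𝓡 d) (I' := 𝓘(ℝ, EuclideanSpace ℝ (Fin d)))
  rw [mfderiv_comp x hg hp, mfderiv_comp x hq hF', mfderiv_eq_fderiv] at h
  rw [chartDeriv, chartDeriv, TangentBundle.continuousLinearMapAt_trivializationAt hx',
    TangentBundle.continuousLinearMapAt_trivializationAt hFx']
  exact congrArg (fun A => A w) h

variable [RiemannianBundle (fun x : M => TangentSpace (𝓡 d) x)]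

/-- A `C^1` map whose derivative is strongly expanding doubles distances measured in charts. -/
theorem eventually_two_mul_norm_le {F : M → M} (hF : ContMDiff (𝓡 d) (𝓡 d) 1 F) {p q z : M}
    (hz : z ∈ (extChartAt (𝓡 d) p).source) (hFz : F z ∈ (extChartAt (𝓡 d) q).source)
    {C : ℝ} (hC : 0 < C) :
    ∀ᶠ xy : M × M in 𝓝 (z, z),
      (∀ w : TangentSpace (𝓡 d) xy.1, ‖chartDeriv d p xy.1 w‖ ≤ C * ‖w‖) →
      (∀ w : TangentSpace (𝓡 d) (F xy.1), ‖w‖ ≤ C * ‖chartDeriv d q (F xy.1) w‖) →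
      4 * C ^ 2 ≤ minNorm (mfderiv (𝓡 d) (𝓡 d) F xy.1) →
      2 * ‖extChartAt (𝓡 d) p xy.1 - extChartAt (𝓡 d) p xy.2‖ ≤
        ‖extChartAt (𝓡 d) q (F xy.1) - extChartAt (𝓡 d) q (F xy.2)‖ := by
  set g := inCharts d F p q with hg
  set a := extChartAt (𝓡 d) p z with ha
  have hgC : ContDiffAt ℝ 1 g a := contDiffAt_inCharts hF hz hFz
  have hstrict := hgC.hasStrictFDerivAt one_ne_zero
  have hcont : ContinuousAt (fderiv ℝ g) a :=
    (hgC.fderiv_right (m := 0) (by norm_num)).continuousAt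
  have h1 : ∀ᶠ uv in 𝓝 (a, a), ‖g uv.1 - g uv.2 - fderiv ℝ g a (uv.1 - uv.2)‖ ≤
      1 * ‖uv.1 - uv.2‖ := hstrict.isLittleO.bound one_pos
  -- Expansion is assumed at `x`, whereas strict differentiability compares with the derivative at
  -- `z`; continuity of the derivative bridges the two.
  have h2 : ∀ᶠ u in 𝓝 a, dist (fderiv ℝ g u) (fderiv ℝ g a) < 1 :=
    Metric.tendsto_nhds.1 hcont 1 one_pos
  have hφ : Tendsto (extChartAt (𝓡 d) p) (𝓝 z) (𝓝 a) := continuousAt_extChartAt' hz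
  have hfst : Tendsto (Prod.fst : M × M → M) (𝓝 (z, z)) (𝓝 z) := continuousAt_fst
  have hsnd : Tendsto (Prod.snd : M × M → M) (𝓝 (z, z)) (𝓝 z) := continuousAt_snd
  have h1' := ((hφ.comp hfst).prodMk_nhds (hφ.comp hsnd)).eventually h1
  have h2' := (hφ.comp hfst).eventually h2
  have hs := extChartAt_source_mem_nhds' hz
  have hFs : ∀ᶠ x in 𝓝 z, F x ∈ (extChartAt (𝓡 d) q).source :=
    hF.continuous.continuousAt.eventually (extChartAt_source_mem_nhds' hFz)
  filter_upwards [h1', h2', hfst.eventually hs, hsnd.eventually hs, hfst.eventually hFs]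
    with ⟨x, y⟩ hxy hx hxs hys hFxs hup hlow hmin
  simp only [Function.comp_apply] at hxy hx hxs hys hFxs hup hlow hmin ⊢
  have hgx : g (extChartAt (𝓡 d) p x) = extChartAt (𝓡 d) q (F x) := by
    simp only [hg, inCharts, (extChartAt (𝓡 d) p).left_inv hxs]
  have hgy : g (extChartAt (𝓡 d) p y) = extChartAt (𝓡 d) q (F y) := by
    simp only [hg, inCharts, (extChartAt (𝓡 d) p).left_inv hys]
  rw [hgx, hgy] at hxy
  set v := extChartAt (𝓡 d) p x - extChartAt (𝓡 d) p y with hv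
  obtain ⟨w, hw⟩ := chartDeriv_surjective hxs v
  have e1 : 4 * C ^ 2 * ‖w‖ ≤ ‖mfderiv (𝓡 d) (𝓡 d) F x w‖ :=
    (mul_le_mul_of_nonneg_right hmin (norm_nonneg _)).trans (minNorm_mul_norm_le _ w)
  have e2 := hlow (mfderiv (𝓡 d) (𝓡 d) F x w)
  rw [← fderiv_inCharts_chartDeriv hF hxs hFxs, hw] at e2
  have e3 := hup w
  rw [hw] at e3
  -- Passing through the two charts costs `C ^ 2`, leaving a factor 4. One unit is lost moving the
  -- derivative from `x` to `z` (`e5`), another in linearizing (`hxy`), so 2 remains.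
  have e4 : 4 * ‖v‖ ≤ ‖fderiv ℝ g (extChartAt (𝓡 d) p x) v‖ := by
    refine le_of_mul_le_mul_left ?_ hC
    calc C * (4 * ‖v‖) ≤ C * (4 * (C * ‖w‖)) := by gcongr
      _ = 4 * C ^ 2 * ‖w‖ := by ring
      _ ≤ _ := e1.trans e2
  have e5 : ‖fderiv ℝ g (extChartAt (𝓡 d) p x) v - fderiv ℝ g a v‖ ≤ 1 * ‖v‖ := by
    rw [← sub_apply]
    rw [dist_eq_norm] at hx
    exact ContinuousLinearMap.le_of_opNorm_le _ hx.le v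
  have e6 := norm_sub_norm_le (fderiv ℝ g (extChartAt (𝓡 d) p x) v) (fderiv ℝ g a v)
  have e7 := norm_sub_norm_le (fderiv ℝ g a v)
    (extChartAt (𝓡 d) q (F x) - extChartAt (𝓡 d) q (F y))
  rw [norm_sub_rev (fderiv ℝ g a v)] at e7
  linarith

variable [IsContMDiffRiemannianBundle (𝓡 d) ∞ (EuclideanSpace ℝ (Fin d))
      (fun x : M => TangentSpace (𝓡 d) x)]

/-- The derivative of a chart distorts norms by a locally bounded factor. -/
theorem exists_eventually_chartDeriv_bounds (p : M) : ∃ C : ℝ, 0 < C ∧ ∀ᶠ x in 𝓝 p,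
    ∀ w : TangentSpace (𝓡 d) x, ‖chartDeriv d p x w‖ ≤ C * ‖w‖ ∧
      ‖w‖ ≤ C * ‖chartDeriv d p x w‖ := by
  have : IsContinuousRiemannianBundle (EuclideanSpace ℝ (Fin d))
    (fun x : M => TangentSpace (𝓡 d) x) := by
    obtain ⟨g, hg, hg'⟩ := IsContMDiffRiemannianBundle.exists_contMDiff (IB := 𝓡 d) (n := ∞)
      (F := EuclideanSpace ℝ (Fin d)) (E := fun x : M => TangentSpace (𝓡 d) x)
    exact ⟨g, hg.continuous, hg'⟩
  obtain ⟨C₁, hC₁, h₁⟩ := eventually_norm_trivializationAt_lt (EuclideanSpace ℝ (Fin d))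
    (fun x : M => TangentSpace (𝓡 d) x) p
  obtain ⟨C₂, hC₂, h₂⟩ := eventually_norm_symmL_trivializationAt_lt (EuclideanSpace ℝ (Fin d))
    (fun x : M => TangentSpace (𝓡 d) x) p
  refine ⟨max C₁ C₂, lt_max_of_lt_left hC₁, ?_⟩
  filter_upwards [h₁, h₂, extChartAt_source_mem_nhds (I := 𝓡 d) p] with x hx₁ hx₂ hx w
  constructor
  · exact (ContinuousLinearMap.le_of_opNorm_le _ hx₁.le w).trans
      (mul_le_mul_of_nonneg_right (le_max_left _ _) (norm_nonneg _))
  · have h := ContinuousLinearMap.le_of_opNorm_le _ hx₂.le (chartDeriv d p x w)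
    rw [chartDeriv, Trivialization.symmL_continuousLinearMapAt _ (by simpa using hx)] at h
    exact h.trans (mul_le_mul_of_nonneg_right (le_max_right _ _) (norm_nonneg _))

end Manifold

/-- A bounded real sequence with positive first term cannot double at every step. -/
theorem not_forall_two_mul_le {u : ℕ → ℝ} (h0 : 0 < u 0) (h1 : ∀ k, u k ≤ 1)
    (h2 : ∀ k, 2 * u k ≤ u (k + 1)) : False := by
  have h : ∀ k, 2 ^ k * u 0 ≤ u k := by
    intro k
    induction k with
    | zero => simp
    | succ k ih => rw [pow_succ]; linarith [h2 k]
  obtain ⟨k, hk⟩ := pow_unbounded_of_one_lt (1 / u 0) (one_lt_two (α := ℝ))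
  rw [div_lt_iff₀ h0] at hk
  linarith [h k, h1 k]

theorem contMDiff_iterate {d : ℕ} {M : Type*} [EMetricSpace M]
    [ChartedSpace (EuclideanSpace ℝ (Fin d)) M] {f : M → M} (hf : ContMDiff (𝓡 d) (𝓡 d) 1 f) (n : ℕ) :
    ContMDiff (𝓡 d) (𝓡 d) 1 f^[n] := by
  induction n with
  | zero => exact contMDiff_id
  | succ n ih => exact ih.comp hf

theorem coe_restrict_iterate {α : Type*} {f : α → α} {s : Set α} (h : MapsTo f s s) (n : ℕ)
    (x : s) : ((h.restrict f s s)^[n] x : α) = f^[n] x := by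
  rw [h.iterate_restrict]
  rfl

/-- The case `ℓ = 0` is excluded because `1 / 0 = 0` makes the expansion condition vacuous there. -/
theorem EFix_subset_EFix {d : ℕ} {M : Type*} [EMetricSpace M]
    [ChartedSpace (EuclideanSpace ℝ (Fin d)) M]
    [RiemannianBundle (fun x : M => TangentSpace (𝓡 d) x)] (f : M → M) (Λ : Set M) (n : ℕ) (α : ℝ) {ℓ ℓ' : ℕ} (hℓ : ℓ ≠ 0)
    (h : ℓ ≤ ℓ') : EFix d f Λ n α ℓ ⊆ EFix d f Λ n α ℓ' := by
  rintro x ⟨h1, h2, h3⟩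
  refine ⟨h1, h2, fun k i hi => le_trans ?_ (h3 k i hi)⟩
  have : (0 : ℝ) < ℓ := by exact_mod_cast Nat.pos_of_ne_zero hℓ
  gcongr

/-! ### Uniform separation of expanding periodic points -/

section Separation

variable {d : ℕ} {M : Type*} [EMetricSpace M] [ChartedSpace (EuclideanSpace ℝ (Fin d)) M]
  [IsManifold (𝓡 d) ∞ M] [RiemannianBundle (fun x : M => TangentSpace (𝓡 d) x)]
  [IsContMDiffRiemannianBundle (𝓡 d) ∞ (EuclideanSpace ℝ (Fin d))
      (fun x : M => TangentSpace (𝓡 d) x)]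

/-- A compact set is covered by finitely many closed pieces of chart domains on which the
derivatives of the charts distort norms by a uniformly bounded factor. -/
theorem exists_finite_closed_chart_cover {Λ : Set M} (hΛ : IsCompact Λ) :
    ∃ (t : Finset M) (W : M → Set M) (C : ℝ), 0 < C ∧ (∀ p, IsClosed (W p)) ∧
      (∀ p, W p ⊆ (extChartAt (𝓡 d) p).source) ∧ (∀ x ∈ Λ, ∃ p ∈ t, x ∈ W p) ∧
      ∀ p ∈ t, ∀ x ∈ W p, ∀ w : TangentSpace (𝓡 d) x,
        ‖chartDeriv d p x w‖ ≤ C * ‖w‖ ∧ ‖w‖ ≤ C * ‖chartDeriv d p x w‖ := by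
  choose C hC0 hC using fun p : M => exists_eventually_chartDeriv_bounds (d := d) p
  -- Closed pieces make "not in `W p`" an open condition, which later discards the pieces missing a
  -- given point.
  have hW : ∀ p : M, ∃ W ∈ 𝓝 p, IsClosed W ∧ W ⊆ (extChartAt (𝓡 d) p).source ∩
      {x | ∀ w : TangentSpace (𝓡 d) x, ‖chartDeriv d p x w‖ ≤ C p * ‖w‖ ∧
        ‖w‖ ≤ C p * ‖chartDeriv d p x w‖} := fun p =>
    exists_mem_nhds_isClosed_subset (inter_mem (extChartAt_source_mem_nhds p) (hC p))
  choose W hWn hWc hWs using hW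
  obtain ⟨t, -, ht⟩ := hΛ.elim_nhds_subcover W fun p _ => hWn p
  have hle : ∀ p ∈ t, C p ≤ 1 + ∑ q ∈ t, C q := fun p hp =>
    (Finset.single_le_sum (fun q _ => (hC0 q).le) hp).trans (by linarith)
  refine ⟨t, W, 1 + ∑ q ∈ t, C q, ?_, hWc, fun p => (hWs p).trans inter_subset_left,
    fun x hx => ?_, fun p hp x hx w => ⟨?_, ?_⟩⟩
  · have := Finset.sum_nonneg (s := t) fun q _ => (hC0 q).le
    linarith
  · obtain ⟨p, hp, hx⟩ := mem_iUnion₂.1 (ht hx)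
    exact ⟨p, hp, hx⟩
  · exact ((hWs p hx).2 w).1.trans (mul_le_mul_of_nonneg_right (hle p hp) (norm_nonneg _))
  · exact ((hWs p hx).2 w).2.trans (mul_le_mul_of_nonneg_right (hle p hp) (norm_nonneg _))

/-- Periodic points which are uniformly expanding along their orbits are uniformly separated. -/
theorem exists_isDynSeparated_EFix {f : M → M} (hf : ContMDiff (𝓡 d) (𝓡 d) 1 f) {Λ : Set M}
    (hΛc : IsCompact Λ) (hΛ : MapsTo f Λ Λ) {α : ℝ} (hα : 0 < α) {ℓ : ℕ} (hℓ : ℓ ≠ 0) :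
    ∃ ε : ℝ≥0∞, 0 < ε ∧ ∀ n ≠ 0, ∀ F : Finset Λ, (F : Set Λ) ⊆ EFix d f Λ n α ℓ →
      IsDynSeparated (hΛ.restrict f Λ Λ) n ε F := by
  have : CompactSpace Λ := isCompact_iff_compactSpace.1 hΛc
  obtain ⟨t, W, C, hC, hWc, hWs, hcov, hbd⟩ := exists_finite_closed_chart_cover (d := d) hΛc
  -- `N` depends on `ℓ`, `α` and the charts but not on the period `n`.
  obtain ⟨N, hN⟩ : ∃ N : ℕ, 4 * C ^ 2 ≤ 1 / (ℓ : ℝ) * Real.exp (N * α) := by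
    have h1 : Tendsto (fun N : ℕ => 1 / (ℓ : ℝ) * Real.exp (N * α)) atTop atTop :=
      (Real.tendsto_exp_atTop.comp
        (tendsto_natCast_atTop_atTop.atTop_mul_const hα)).const_mul_atTop (by positivity)
    exact (h1.eventually_ge_atTop _).exists
  have hF : ContMDiff (𝓡 d) (𝓡 d) 1 f^[N] := contMDiff_iterate hf N
  set T := hΛ.restrict f Λ Λ with hT
  have hloc : ∀ᶠ xy : Λ × Λ in uniformity Λ, ∀ p ∈ t, (xy.1 : M) ∈ W p →
      ((xy.2 : M) ∈ (extChartAt (𝓡 d) p).source ∧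
      ‖extChartAt (𝓡 d) p (xy.1 : M) - extChartAt (𝓡 d) p (xy.2 : M)‖ ≤ 1) ∧
      ∀ q ∈ t, f^[N] (xy.1 : M) ∈ W q →
        4 * C ^ 2 ≤ minNorm (mfderiv (𝓡 d) (𝓡 d) f^[N] (xy.1 : M)) →
        2 * ‖extChartAt (𝓡 d) p (xy.1 : M) - extChartAt (𝓡 d) p (xy.2 : M)‖ ≤
        ‖extChartAt (𝓡 d) q (f^[N] (xy.1 : M)) - extChartAt (𝓡 d) q (f^[N] (xy.2 : M))‖ := by
    -- On a compact space the entourages are the neighbourhoods of the diagonal, so a local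
    -- statement at each `(z, z)` suffices.
    rw [compactSpace_uniformity, eventually_iSup]
    intro z
    rw [Filter.eventually_all_finset]
    intro p hp
    have hc : Tendsto (fun xy : Λ × Λ => ((xy.1 : M), (xy.2 : M))) (𝓝 (z, z))
        (𝓝 ((z : M), (z : M))) := (by fun_prop : Continuous fun xy : Λ × Λ =>
        ((xy.1 : M), (xy.2 : M))).tendsto (z, z)
    have hc1 : Tendsto (fun xy : Λ × Λ => (xy.1 : M)) (𝓝 (z, z)) (𝓝 (z : M)) :=
      (by fun_prop : Continuous fun xy : Λ × Λ => (xy.1 : M)).tendsto (z, z)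
    have hc2 : Tendsto (fun xy : Λ × Λ => (xy.2 : M)) (𝓝 (z, z)) (𝓝 (z : M)) :=
      (by fun_prop : Continuous fun xy : Λ × Λ => (xy.2 : M)).tendsto (z, z)
    by_cases hzp : (z : M) ∈ W p
    · have hzs := hWs p hzp
      have hφ := continuousAt_extChartAt' (I := 𝓡 d) hzs
      have hd : Tendsto (fun xy : Λ × Λ =>
          ‖extChartAt (𝓡 d) p (xy.1 : M) - extChartAt (𝓡 d) p (xy.2 : M)‖) (𝓝 (z, z)) (𝓝 0) := by
        simpa [-extChartAt] using ((hφ.tendsto.comp hc1).sub (hφ.tendsto.comp hc2)).norm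
      have hall : ∀ᶠ xy : Λ × Λ in 𝓝 (z, z), ∀ q ∈ t, f^[N] (xy.1 : M) ∈ W q → (xy.1 : M) ∈ W p →
          4 * C ^ 2 ≤ minNorm (mfderiv (𝓡 d) (𝓡 d) f^[N] (xy.1 : M)) →
          2 * ‖extChartAt (𝓡 d) p (xy.1 : M) - extChartAt (𝓡 d) p (xy.2 : M)‖ ≤
          ‖extChartAt (𝓡 d) q (f^[N] (xy.1 : M)) - extChartAt (𝓡 d) q (f^[N] (xy.2 : M))‖ := by
        rw [Filter.eventually_all_finset]
        intro q hq
        by_cases hzq : f^[N] (z : M) ∈ W q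
        · filter_upwards [hc.eventually (eventually_two_mul_norm_le hF hzs (hWs q hzq) hC)]
            with xy h hxq hxp hm
          exact h (fun w => (hbd p hp _ hxp w).1) (fun w => (hbd q hq _ hxq w).2) hm
        · filter_upwards [(hF.continuous.continuousAt.tendsto.comp hc1).eventually
            ((hWc q).isOpen_compl.mem_nhds hzq)] with xy h hxq
          exact absurd hxq h
      filter_upwards [hall, hd.eventually_le_const one_pos,
        hc2.eventually (extChartAt_source_mem_nhds' hzs)] with xy h1 h2 h3 hxp
      exact ⟨⟨h3, h2⟩, fun q hq hxq hm => h1 q hq hxq hxp hm⟩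
    · filter_upwards [hc1.eventually ((hWc p).isOpen_compl.mem_nhds hzp)] with xy h hxp
      exact absurd hxp h
  obtain ⟨ε, hε, hlocε⟩ := mem_uniformity_edist.1 hloc
  -- Failure of separation gives only `≤ ε'`, while the entourage needs `< ε`.
  obtain ⟨ε', hε'0, hε'⟩ := exists_between hε
  refine ⟨ε', hε'0, fun n hn F hFE x hx y hy hxy => ?_⟩
  by_contra! hcon
  have hper : ∀ z ∈ F, Function.IsPeriodicPt T n z := fun z hz => by
    refine Subtype.ext ?_
    rw [hT, coe_restrict_iterate]
    exact (hFE hz).1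
  -- A common period extends closeness from the times below `n` to all times; `hexp` extends the
  -- expansion bound likewise.
  have hclose : ∀ k, edist (T^[k] x) (T^[k] y) < ε := fun k => by
    rw [← (hper x hx).iterate_mod_apply k, ← (hper y hy).iterate_mod_apply k]
    exact (hcon _ (Nat.mod_lt _ (Nat.pos_of_ne_zero hn))).trans_lt hε'
  have hexp : ∀ k, 4 * C ^ 2 ≤ minNorm (mfderiv (𝓡 d) (𝓡 d) f^[N] (T^[k] x : Λ)) := fun k => by
    rw [← (hper x hx).iterate_mod_apply k, hT, coe_restrict_iterate]
    exact hN.trans ((hFE hx).2.2 N _ (Nat.mod_lt _ (Nat.pos_of_ne_zero hn)))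
  choose P hPt hPW using fun k : ℕ => hcov (T^[k * N] x : Λ) (T^[k * N] x).2
  have hstep : ∀ k (z : Λ), f^[N] (T^[k * N] z : Λ) = (T^[(k + 1) * N] z : Λ) := fun k z => by
    rw [← coe_restrict_iterate hΛ, ← hT, ← Function.iterate_add_apply, add_mul, one_mul, add_comm]
  have hkey := fun k => hlocε (hclose (k * N)) (P k) (hPt k) (hPW k)
  -- The distance at time `k * N` is read in a chart whose piece contains the orbit point of `x`. It
  -- starts positive by injectivity of the chart, never exceeds 1, and doubles at each step.
  refine not_forall_two_mul_le (u := fun k => ‖extChartAt (𝓡 d) (P k) (T^[k * N] x : Λ) -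
    extChartAt (𝓡 d) (P k) (T^[k * N] y : Λ)‖) ?_ (fun k => (hkey k).1.2) fun k => ?_
  · rw [norm_pos_iff, sub_ne_zero]
    intro h
    have := (extChartAt (𝓡 d) (P 0)).injOn (hWs _ (hPW 0)) (hkey 0).1.1 h
    rw [zero_mul] at this
    exact hxy (Subtype.ext this)
  · have h := (hkey k).2 (P (k + 1)) (hPt (k + 1))
    simp only [hstep] at h
    exact h (hPW (k + 1)) (hexp _)

end Separation

/-- An extended real sequence which is monotone and bounded by `b` on the positive indices converges
to a limit which is at most `b`. -/
theorem exists_tendsto_atTop_le {u : ℕ → EReal} {b : EReal}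
    (hmono : ∀ m n, m ≠ 0 → m ≤ n → u m ≤ u n) (hb : ∀ n ≠ 0, u n ≤ b) :
    ∃ L, Tendsto u atTop (𝓝 L) ∧ L ≤ b := by
  -- The shift drops the index 0, where neither hypothesis applies.
  have h : Monotone fun n => u (n + 1) := fun m n hmn => hmono _ _ (by omega) (by omega)
  refine ⟨⨆ n, u (n + 1), ?_, iSup_le fun n => hb _ (by omega)⟩
  exact (tendsto_add_atTop_iff_nat 1).1 (tendsto_atTop_iSup h)

end LargeDev

theorem theorem5p2 {d : ℕ} {M : Type*} [EMetricSpace M]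
    [ChartedSpace (EuclideanSpace ℝ (Fin d)) M] [IsManifold (𝓡 d) ∞ M]
    [RiemannianBundle (fun x : M => TangentSpace (𝓡 d) x)]
    [IsContMDiffRiemannianBundle (𝓡 d) ∞ (EuclideanSpace ℝ (Fin d))
      (fun x : M => TangentSpace (𝓡 d) x)]
    [IsRiemannianManifold (𝓡 d) M] [MeasurableSpace M] [BorelSpace M]
    (f : M → M) (ε : ℝ≥0) (hε : 0 < ε) (hε1 : ε ≤ 1) (hf : LargeDev.IsC1Holder d ε f)
    (Λ : Set M) (hΛc : IsCompact Λ) (hΛ : MapsTo f Λ Λ) (hΛm : LargeDev.IsLocallyMaximal f Λ)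
    (μ : Measure Λ) [IsProbabilityMeasure μ] (hμ : Ergodic (hΛ.restrict f Λ Λ) μ)
    (hμ1 : 0 < LargeDev.lyapunovMinMeasure d f μ)
    (hμ2 : 0 < LargeDev.ksEntropy (hΛ.restrict f Λ Λ) μ)
    (φ : C(Λ, ℝ)) (α δ : ℝ) (hα : 0 < α) (hδ : 0 < δ) :
    ∃ L : EReal,
      Tendsto (fun ℓ : ℕ =>
        limsup (fun n : ℕ =>
          ENNReal.log (({x ∈ LargeDev.EFix d f Λ n α ℓ |
            δ ≤ |(1 / (n : ℝ)) * birkhoffSum (hΛ.restrict f Λ Λ) φ n x - ∫ y, φ y ∂μ|}.encard :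
              ℕ∞) : ℝ≥0∞) / (n : EReal)) atTop) atTop (𝓝 L) ∧
      L ≤ ⨆ ν ∈ {ν : Measure Λ | ν ∈ LargeDev.invariantMeasures (hΛ.restrict f Λ Λ) ∧
          δ ≤ |(∫ y, φ y ∂ν) - ∫ y, φ y ∂μ|},
        LargeDev.genEntropy (hΛ.restrict f Λ Λ) ν := by
  have : CompactSpace Λ := isCompact_iff_compactSpace.1 hΛc
  refine LargeDev.exists_tendsto_atTop_le (fun m n hm hmn => ?_) (fun ℓ hℓ => ?_)
  · refine limsup_le_limsup (Eventually.of_forall fun k => ?_)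
    refine EReal.div_le_div_right_of_nonneg (by positivity) (ENNReal.log_monotone ?_)
    refine ENat.toENNReal_le.2 (encard_le_encard fun x hx => ?_)
    exact ⟨LargeDev.EFix_subset_EFix f Λ k α hm hmn hx.1, hx.2⟩
  · obtain ⟨ε', hε', hsep⟩ := LargeDev.exists_isDynSeparated_EFix hf.1 hΛc hΛ hα hℓ
    refine LargeDev.limsup_log_encard_periodic_le (A := {r : ℝ | δ ≤ |r - ∫ y, φ y ∂μ|})
      (hf.1.continuous.restrict hΛ) φ (isClosed_le (by fun_prop) (by fun_prop)) _ hε'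
      (fun n hn F hF => hsep n hn F (hF.trans fun x hx => hx.1)) (fun n x hx => ?_)
      (fun n x hx => hx.2)
    refine Subtype.ext ?_
    rw [LargeDev.coe_restrict_iterate]
    exact hx.1.1
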